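/- Let $q\in(0,1]$ and let $f(x)=\sum_{y\in Y}c_y e^{2\pi i yx}$ be an exponential sum with a finite set of frequencies $Y\subset[0,1)$ and coefficients $c_y\in\mathbb{C}\setminus\{0\}$, and suppose that $f$ is $q$-separated, i.e. $\min_{k\in\mathbb{Z}}|y-y'-k|\ge q$ for all $y,y'\in Y$ with $y\ne y'$. Let $A<B$ be integers. Then \[ \Bigl(B-A+2-\frac1q\Bigr)\sum_{y\in Y}|c_y|^2\;\le\;\sum_{k=A}^{B}|f(k)|^2\;\le\;\Bigl(B-A+\frac1q\Bigr)\sum_{y\in Y}|c_y|^2 . \] -/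

import Mathlib

/-- The wrap-around distance `min_{k ∈ ℤ} |y - y' - k|` of two frequencies. -/
noncomputable def wrapDist (y y' : ℝ) : ℝ := ⨅ k : ℤ, |y - y' - (k : ℝ)|

/-- The infimum in `wrapDist` is a minimum. -/
theorem wrapDist_isLeast (y y' : ℝ) :
    IsLeast (Set.range fun k : ℤ => |y - y' - (k : ℝ)|) (wrapDist y y') := by
  have h : IsLeast (Set.range fun k : ℤ => |y - y' - (k : ℝ)|)
      |y - y' - (round (y - y') : ℝ)| := by
    refine ⟨⟨round (y - y'), rfl⟩, ?_⟩
    rintro _ ⟨k, rfl⟩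
    exact round_le (y - y') k
  have e : wrapDist y y' = |y - y' - (round (y - y') : ℝ)| := h.csInf_eq
  rw [e]
  exact h

/-- The separation of a finite set of frequencies: the minimum of `wrapDist y y'` over all pairs of
distinct `y, y' ∈ Y`. The minimum over no pairs at all (at most one frequency) is `⊤`. -/
noncomputable def sep (Y : Finset ℝ) : EReal :=
  ⨅ y ∈ Y, ⨅ y' ∈ Y, ⨅ _ : y ≠ y', ((wrapDist y y' : ℝ) : EReal)

/-- An exponential sum `∑_{y ∈ Y} c_y e^{2π i y ·}`, given by its finite set `Y ⊂ [0,1)` of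
frequencies and the vector `c` of its nonzero coefficients, indexed by `Y`. The norm of `coeff` is
the `ℓ²` norm. -/
structure ExpSum where
  /-- the frequencies -/
  freq : Finset ℝ
  freq_mem : ∀ y ∈ freq, y ∈ Set.Ico (0 : ℝ) 1
  /-- the coefficients -/
  coeff : EuclideanSpace ℂ freq
  coeff_ne_zero : ∀ y : freq, coeff y ≠ 0

/-- The function `x ↦ ∑_{y ∈ Y} c_y e^{2π i y x}` on the real line. -/
noncomputable def ExpSum.eval (f : ExpSum) (x : ℝ) : ℂ :=
  ∑ y : f.freq, f.coeff y * Complex.exp (2 * Real.pi * Complex.I * ((y : ℝ) : ℂ) * (x : ℂ))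

/-- The well-separated exponential sums `𝒮(q)`. -/
def WellSeparated (q : ℝ) : Set ExpSum := {f | (q : EReal) ≤ sep f.freq}

/-!
The two inequalities are a sharp large sieve and its companion lower bound. They come from the
Hilbert inequality of Montgomery and Vaughan with cosecant kernel, sharpened by a dilation of Cohen.

*Hilbert inequality* (`norm_sum_cscMatrix_le`). Let `T` have the entries `csc π(x r - x s)` off the
diagonal, for points `x r` that are `δ`-separated modulo `1`. The matrix `i T` is Hermitian, so its
form is bounded by its largest eigenvalue `μ` in absolute value. Expanding `‖T v‖²` at an
eigenvector `v` by the addition theorem of the cotangent, the main off-diagonal part cancels, and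
`μ²` is at most the largest column sum of `csc² + 2 |csc cot|` (`sq_le_of_cscMatrix_eigenvector`).
Since `(1 + 2 cos y) / sin² y ≤ 3 / y²` (`sq_mul_one_add_two_mul_cos_le`) and separated points are
at least as sparse as an arithmetic progression, this column sum is at most
`2 · 3 / (π² δ²) · ζ(2) = 1 / δ²` (`sum_cscMatrix_sq_add_le`).

*Mean squares* (`abs_sum_norm_sq_sub_le`). Opening `∑ |f(k)|²` over `[A, B]` and summing the
geometric series, the off-diagonal terms are half the difference of two such forms (up to the
factor `1 / i`), so the mean square deviates from
`(B - A + 1) ∑ |c|²` by at most `(1 / δ) ∑ |c|²`.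

*Dilation* (`abs_mul_sum_norm_sq_sub_le`). Replacing each frequency `y` by the `K` frequencies
`(y + j) / K`, which are `q / K`-separated because `q ≤ 1`, gives a sum that vanishes at the
integers not divisible by `K`. The interval may then be extended or shrunk freely between multiples
of `K`: the length `K (B - A) + 1` gives the upper bound and `K (B - A + 2) - 1` the lower bound
as `K → ∞`.
-/

/-! ### A trigonometric inequality and a sum over separated points -/

/-- The function `(1 + 2 cos y) / sin² y` stays below its leading term `3 / y²` at the origin. -/
theorem sq_mul_one_add_two_mul_cos_le {y : ℝ} (h0 : 0 ≤ y) (h1 : y ≤ Real.pi / 2) :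
    y ^ 2 * (1 + 2 * Real.cos y) ≤ 3 * Real.sin y ^ 2 := by
  -- With `z = y / 2` and `t = sin² z` this reads `z² (3 - 4 t) ≤ 3 t (1 - t)`; the difference
  -- increases in `t`, so `t` may be replaced by the lower bound coming from `sin z ≥ z - z³ / 6`.
  obtain ⟨z, rfl⟩ : ∃ z, y = 2 * z := ⟨y / 2, by ring⟩
  have hz0 : 0 ≤ z := by linarith
  have hz1 : z ≤ 0.8 := by linarith [Real.pi_lt_d2]
  have hs := Real.sin_ge_sub_cube hz0
  have hs1 : Real.sin z ≤ z := Real.sin_le hz0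
  rw [Real.cos_two_mul, Real.sin_two_mul]
  have hcs := Real.sin_sq_add_cos_sq z
  set s := Real.sin z
  have hc : Real.cos z ^ 2 = 1 - s ^ 2 := by linarith
  have hZ : z ^ 2 ≤ 0.64 := by nlinarith
  have hlow : 0 ≤ z - z ^ 3 / 6 := by nlinarith [mul_nonneg hz0 (sq_nonneg z)]
  have ht : (z - z ^ 3 / 6) ^ 2 ≤ s ^ 2 := pow_le_pow_left₀ hlow hs 2
  have ht1 : s ^ 2 ≤ z ^ 2 := pow_le_pow_left₀ (hlow.trans hs) hs1 2
  rw [mul_pow 2 z, mul_pow (2 * s), mul_pow 2 s, hc]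
  set t := s ^ 2
  have key : z ^ 2 * (3 - 4 * t) ≤ 3 * t * (1 - t) := by
    set Z := z ^ 2 with hZdef
    have hZ0 : 0 ≤ Z := sq_nonneg z
    have hw : (z - z ^ 3 / 6) ^ 2 = Z * (1 - Z / 6) ^ 2 := by rw [hZdef]; ring
    rw [hw] at ht
    set w := Z * (1 - Z / 6) ^ 2 with hwdef
    have hwZ : w ≤ Z := ht.trans ht1
    have hmono : 0 ≤ (t - w) * (3 - 3 * (t + w) + 4 * Z) :=
      mul_nonneg (by linarith) (by linarith)
    have hbase : 0 ≤ 3 * w * (1 - w) - Z * (3 - 4 * w) := by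
      have he0 : 0 ≤ Z / 3 - Z ^ 2 / 36 := by nlinarith
      have he1 : 0 ≤ 2 - 3 * (Z / 3 - Z ^ 2 / 36) := by nlinarith
      have hp : 3 * w * (1 - w) - Z * (3 - 4 * w) = Z ^ 2 *
          (Z / 12 + (Z / 3 - Z ^ 2 / 36) * (2 - 3 * (Z / 3 - Z ^ 2 / 36))) := by
        rw [hwdef]; ring
      rw [hp]
      positivity
    nlinarith
  nlinarith

/-- The form in which the trigonometric inequality is applied, for a frequency difference `d`
reduced to the interval `[-1/2, 1/2]`. -/
theorem inv_sin_sq_add_le {d : ℝ} (hd : |d| ≤ 1 / 2) (hd0 : d ≠ 0) :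
    (1 / Real.sin (Real.pi * d)) ^ 2 + 2 * |1 / Real.sin (Real.pi * d) *
      (Real.cos (Real.pi * d) / Real.sin (Real.pi * d))| ≤ 3 / Real.pi ^ 2 * (1 / d ^ 2) := by
  wlog hpos : 0 < d generalizing d
  · have := this (d := -d) (by rwa [abs_neg]) (neg_ne_zero.2 hd0)
      (by rcases hd0.lt_or_gt with h | h
          · linarith
          · exact absurd h hpos)
    simpa only [mul_neg, Real.sin_neg, Real.cos_neg, div_neg, neg_mul, abs_neg, neg_sq, neg_neg] using this
  rw [abs_of_pos hpos] at hd
  have hy0 : 0 < Real.pi * d := by positivity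
  have hy1 : Real.pi * d ≤ Real.pi / 2 := by nlinarith [Real.pi_pos]
  have hs : 0 < Real.sin (Real.pi * d) :=
    Real.sin_pos_of_pos_of_lt_pi hy0 (by linarith [Real.pi_pos])
  have hc : 0 ≤ Real.cos (Real.pi * d) :=
    Real.cos_nonneg_of_mem_Icc ⟨by linarith [Real.pi_pos], hy1⟩
  have h := sq_mul_one_add_two_mul_cos_le hy0.le hy1
  rw [abs_of_nonneg (by positivity)]
  have e1 : (1 / Real.sin (Real.pi * d)) ^ 2 + 2 * (1 / Real.sin (Real.pi * d) *
      (Real.cos (Real.pi * d) / Real.sin (Real.pi * d))) =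
      (1 + 2 * Real.cos (Real.pi * d)) / Real.sin (Real.pi * d) ^ 2 := by
    field_simp
  have e2 : 3 / Real.pi ^ 2 * (1 / d ^ 2) = 3 / (Real.pi * d) ^ 2 := by
    field_simp
  rw [e1, e2, div_le_div_iff₀ (by positivity) (by positivity)]
  linarith

/-- Positive `δ`-separated points, none below `δ`: comparison with the progression `δ, 2δ, …`, by
injectivity of `i ↦ ⌊d i / δ⌋`. -/
theorem sum_one_div_sq_le_of_pos {ι : Type*} (S : Finset ι) (d : ι → ℝ) {δ : ℝ} (hδ : 0 < δ)
    (hd : ∀ i ∈ S, δ ≤ d i) (hsep : ∀ i ∈ S, ∀ j ∈ S, i ≠ j → δ ≤ |d i - d j|) :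
    ∑ i ∈ S, 1 / d i ^ 2 ≤ Real.pi ^ 2 / (6 * δ ^ 2) := by
  classical
  have hnn : ∀ i ∈ S, 0 ≤ d i / δ := fun i hi => div_nonneg (hδ.le.trans (hd i hi)) hδ.le
  have hinj : Set.InjOn (fun i => ⌊d i / δ⌋₊) (S : Set ι) := by
    intro i hi j hj hij
    by_contra hne
    have hij' : ⌊d i / δ⌋ = ⌊d j / δ⌋ := by
      rw [← Int.natCast_floor_eq_floor (hnn i hi), ← Int.natCast_floor_eq_floor (hnn j hj)]
      exact congrArg _ hij
    have hlt := Int.abs_sub_lt_one_of_floor_eq_floor hij'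
    rw [← sub_div, abs_div, abs_of_pos hδ, div_lt_one hδ] at hlt
    exact absurd hlt (not_lt.2 (hsep i hi j hj hne))
  have hterm : ∀ i ∈ S, 1 / d i ^ 2 ≤ 1 / δ ^ 2 * (1 / ((⌊d i / δ⌋₊ : ℕ) : ℝ) ^ 2) := by
    intro i hi
    have h1 : (1 : ℝ) ≤ ((⌊d i / δ⌋₊ : ℕ) : ℝ) := by
      exact_mod_cast Nat.le_floor (by simpa using (one_le_div hδ).2 (hd i hi))
    have h2 : δ * ((⌊d i / δ⌋₊ : ℕ) : ℝ) ≤ d i := by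
      have := Nat.floor_le (hnn i hi)
      rwa [le_div_iff₀ hδ, mul_comm] at this
    rw [div_mul_div_comm, one_mul, ← mul_pow]
    exact one_div_le_one_div_of_le (by positivity) (pow_le_pow_left₀ (by positivity) h2 2)
  calc ∑ i ∈ S, 1 / d i ^ 2 ≤ ∑ i ∈ S, 1 / δ ^ 2 * (1 / ((⌊d i / δ⌋₊ : ℕ) : ℝ) ^ 2) :=
        Finset.sum_le_sum hterm
    _ = 1 / δ ^ 2 * ∑ n ∈ S.image fun i => ⌊d i / δ⌋₊, 1 / (n : ℝ) ^ 2 := by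
        rw [Finset.sum_image hinj, Finset.mul_sum]
    _ ≤ 1 / δ ^ 2 * (Real.pi ^ 2 / 6) := by
        gcongr
        exact sum_le_hasSum _ (fun n _ => by positivity) hasSum_zeta_two
    _ = Real.pi ^ 2 / (6 * δ ^ 2) := by field_simp

theorem sum_one_div_sq_le {ι : Type*} (S : Finset ι) (d : ι → ℝ) {δ : ℝ} (hδ : 0 < δ)
    (hd : ∀ i ∈ S, δ ≤ |d i|) (hsep : ∀ i ∈ S, ∀ j ∈ S, i ≠ j → δ ≤ |d i - d j|) :
    ∑ i ∈ S, 1 / d i ^ 2 ≤ Real.pi ^ 2 / (3 * δ ^ 2) := by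
  classical
  rw [← Finset.sum_filter_add_sum_filter_not S (fun i => 0 < d i)]
  have h1 := sum_one_div_sq_le_of_pos (S.filter fun i => 0 < d i) d hδ
    (fun i hi => by
      rw [Finset.mem_filter] at hi
      simpa only [abs_of_pos hi.2] using hd i hi.1)
    (fun i hi j hj => hsep i (Finset.mem_filter.1 hi).1 j (Finset.mem_filter.1 hj).1)
  have h2 := sum_one_div_sq_le_of_pos (S.filter fun i => ¬ 0 < d i) (fun i => - d i) hδ
    (fun i hi => by
      rw [Finset.mem_filter] at hi
      simpa only [abs_of_nonpos (not_lt.1 hi.2)] using hd i hi.1)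
    (fun i hi j hj hij => by
      have := hsep i (Finset.mem_filter.1 hi).1 j (Finset.mem_filter.1 hj).1 hij
      rwa [neg_sub_neg, abs_sub_comm])
  simp only [neg_sq] at h2
  calc _ ≤ _ := add_le_add h1 h2
    _ = _ := by field_simp; norm_num

/-! ### The Hilbert inequality with cosecant kernel -/

/-- The matrix of `csc (θ r - θ s)`. As `1 / 0 = 0`, its diagonal vanishes. -/
noncomputable def cscMatrix {ι : Type*} (θ : ι → ℝ) (r s : ι) : ℝ := 1 / Real.sin (θ r - θ s)

/-- The matrix of `cot (θ r - θ s)`. As `1 / 0 = 0`, its diagonal vanishes. -/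
noncomputable def cotMatrix {ι : Type*} (θ : ι → ℝ) (r s : ι) : ℝ :=
  Real.cos (θ r - θ s) / Real.sin (θ r - θ s)

section Kernels

variable {ι : Type*} (θ : ι → ℝ)

@[simp] theorem cscMatrix_self (r : ι) : cscMatrix θ r r = 0 := by simp [cscMatrix]

@[simp] theorem cotMatrix_self (r : ι) : cotMatrix θ r r = 0 := by simp [cotMatrix]

theorem cscMatrix_swap (r s : ι) : cscMatrix θ s r = -cscMatrix θ r s := by
  rw [cscMatrix, cscMatrix, ← neg_sub (θ r), Real.sin_neg, div_neg]

theorem cotMatrix_swap (r s : ι) : cotMatrix θ s r = -cotMatrix θ r s := by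
  rw [cotMatrix, cotMatrix, ← neg_sub (θ r), Real.sin_neg, Real.cos_neg, div_neg]

variable {θ}

/-- The addition theorem of the cotangent. -/
theorem cscMatrix_mul_cscMatrix {r s t : ι} (hs : Real.sin (θ r - θ s) ≠ 0)
    (ht : Real.sin (θ r - θ t) ≠ 0) (hst : Real.sin (θ s - θ t) ≠ 0) :
    cscMatrix θ r s * cscMatrix θ r t = cscMatrix θ s t * (cotMatrix θ r s - cotMatrix θ r t) := by
  have h : Real.sin (θ s - θ t) = Real.sin (θ r - θ t) * Real.cos (θ r - θ s) -
      Real.cos (θ r - θ t) * Real.sin (θ r - θ s) := by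
    rw [← Real.sin_sub]
    ring_nf
  simp only [cscMatrix, cotMatrix]
  rw [div_sub_div _ _ hs ht, div_mul_div_comm, div_mul_div_comm, one_mul, one_mul,
    div_eq_div_iff (mul_ne_zero hs ht) (mul_ne_zero hst (mul_ne_zero hs ht)), h]
  ring

variable [Fintype ι] [DecidableEq ι]

/-- The entries of `Tᵀ T` for the cosecant matrix `T`. Off the diagonal the leading part
`T s t (a s - a t)`, with `a` the column sums of the cotangent matrix, drops out of the quadratic
form at an eigenvector of `T`. -/
theorem sum_cscMatrix_mul_cscMatrix (hθ : ∀ r s, r ≠ s → Real.sin (θ r - θ s) ≠ 0) (s t : ι) :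
    ∑ r, cscMatrix θ r s * cscMatrix θ r t =
      (if s = t then ∑ r, cscMatrix θ r s ^ 2 else 0) +
      cscMatrix θ s t * ((∑ r, cotMatrix θ r s) - ∑ r, cotMatrix θ r t) +
      2 * (cscMatrix θ s t * cotMatrix θ s t) := by
  split_ifs with hst
  · subst hst
    simp [sq]
  · have h : ∀ r, cscMatrix θ r s * cscMatrix θ r t =
        cscMatrix θ s t * (cotMatrix θ r s - cotMatrix θ r t) +
        ((if r = s then cscMatrix θ s t * cotMatrix θ s t else 0) +
        (if r = t then cscMatrix θ s t * cotMatrix θ s t else 0)) := by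
      intro r
      by_cases hrs : r = s
      · subst hrs
        simp [hst]
      by_cases hrt : r = t
      · subst hrt
        rw [cotMatrix_swap θ s r]
        simp [hrs]
      rw [cscMatrix_mul_cscMatrix (hθ _ _ hrs) (hθ _ _ hrt) (hθ _ _ hst)]
      simp [hrs, hrt]
    rw [Finset.sum_congr rfl fun r _ => h r, Finset.sum_add_distrib, Finset.sum_add_distrib,
      ← Finset.mul_sum, Finset.sum_sub_distrib]
    simp
    ring

/-- Eigenvalues of the Hermitian matrix `i T`, where `T` is the cosecant matrix: `‖T v‖²` is
expanded and the cotangent column sums cancel because `T v = -i μ v`. -/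
theorem sq_le_of_cscMatrix_eigenvector (hθ : ∀ r s, r ≠ s → Real.sin (θ r - θ s) ≠ 0) {D : ℝ}
    (hD : ∀ s, ∑ r, (cscMatrix θ r s ^ 2 + 2 * |cscMatrix θ r s * cotMatrix θ r s|) ≤ D)
    (v : ι → ℂ) (hv : v ≠ 0) (μ : ℝ)
    (hμ : ∀ r, ∑ s, (cscMatrix θ r s : ℂ) * v s = -(Complex.I * μ * v r)) :
    μ ^ 2 ≤ D := by
  set T := cscMatrix θ with hT
  set C := cotMatrix θ with hC
  set a : ι → ℝ := fun s => ∑ r, C r s with ha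
  set b : ι → ℝ := fun s => ∑ r, T r s ^ 2 with hb
  have hTswap : ∀ r s, T s r = -T r s := cscMatrix_swap θ
  have hCswap : ∀ r s, C s r = -C r s := cotMatrix_swap θ
  -- the conjugate of the eigenvector equation
  have hμ' : ∀ r, ∑ s, (T r s : ℂ) * starRingEnd ℂ (v s) = Complex.I * μ * starRingEnd ℂ (v r) := by
    intro r
    have := congrArg (starRingEnd ℂ) (hμ r)
    simpa [map_sum] using this
  have e1 : ∑ r, (∑ s, (T r s : ℂ) * v s) * (∑ t, (T r t : ℂ) * starRingEnd ℂ (v t)) =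
      ∑ s, ∑ t, v s * starRingEnd ℂ (v t) * ((∑ r, T r s * T r t : ℝ) : ℂ) := by
    simp_rw [Finset.sum_mul_sum]
    rw [Finset.sum_comm]
    refine Finset.sum_congr rfl fun s _ => ?_
    rw [Finset.sum_comm]
    refine Finset.sum_congr rfl fun t _ => ?_
    push_cast
    rw [Finset.mul_sum]
    exact Finset.sum_congr rfl fun r _ => by ring
  have e2 : ∑ r, (∑ s, (T r s : ℂ) * v s) * (∑ t, (T r t : ℂ) * starRingEnd ℂ (v t)) =
      ((μ ^ 2 * ∑ r, ‖v r‖ ^ 2 : ℝ) : ℂ) := by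
    push_cast
    rw [Finset.mul_sum]
    refine Finset.sum_congr rfl fun r _ => ?_
    rw [hμ, hμ', ← Complex.mul_conj']
    linear_combination (-(μ : ℂ) ^ 2 * v r * starRingEnd ℂ (v r)) * Complex.I_sq
  have e3 : ∑ s, ∑ t, v s * starRingEnd ℂ (v t) * ((T s t * (a s - a t) : ℝ) : ℂ) = 0 := by
    have h1 : ∑ s, ∑ t, v s * starRingEnd ℂ (v t) * ((T s t * a s : ℝ) : ℂ) =
        ∑ s, Complex.I * μ * a s * (v s * starRingEnd ℂ (v s)) := by
      refine Finset.sum_congr rfl fun s _ => ?_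
      calc _ = v s * a s * ∑ t, (T s t : ℂ) * starRingEnd ℂ (v t) := by
            rw [Finset.mul_sum]
            exact Finset.sum_congr rfl fun t _ => by push_cast; ring
        _ = _ := by rw [hμ']; ring
    have h2 : ∑ s, ∑ t, v s * starRingEnd ℂ (v t) * ((T s t * a t : ℝ) : ℂ) =
        ∑ t, Complex.I * μ * a t * (v t * starRingEnd ℂ (v t)) := by
      rw [Finset.sum_comm]
      refine Finset.sum_congr rfl fun t _ => ?_
      calc _ = -(starRingEnd ℂ (v t) * a t * ∑ s, (T t s : ℂ) * v s) := by
            rw [Finset.mul_sum, ← Finset.sum_neg_distrib]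
            exact Finset.sum_congr rfl fun s _ => by rw [hTswap t s]; push_cast; ring
        _ = _ := by rw [hμ]; ring
    simp only [mul_sub, Complex.ofReal_sub, Finset.sum_sub_distrib]
    rw [h1, h2, sub_self]
  have e4 : ((μ ^ 2 * ∑ r, ‖v r‖ ^ 2 : ℝ) : ℂ) = ((∑ s, ‖v s‖ ^ 2 * b s : ℝ) : ℂ) +
      ∑ s, ∑ t, v s * starRingEnd ℂ (v t) * ((2 * (T s t * C s t) : ℝ) : ℂ) := by
    rw [← e2, e1]
    simp only [hT, sum_cscMatrix_mul_cscMatrix hθ]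
    simp only [Complex.ofReal_add, mul_add, Finset.sum_add_distrib]
    rw [e3, add_zero]
    congr 1
    push_cast
    refine Finset.sum_congr rfl fun s _ => ?_
    simp [hb, hT, apply_ite, ← Complex.mul_conj']
  have e5 : ‖∑ s, ∑ t, v s * starRingEnd ℂ (v t) * ((2 * (T s t * C s t) : ℝ) : ℂ)‖ ≤
      ∑ s, ‖v s‖ ^ 2 * ∑ r, 2 * |T r s * C r s| := by
    have hsym : ∀ s t, |T s t * C s t| = |T t s * C t s| := by
      intro s t
      rw [hTswap t s, hCswap t s, neg_mul_neg]
    calc _ ≤ ∑ s, ∑ t, (‖v s‖ ^ 2 * |T t s * C t s| + ‖v t‖ ^ 2 * |T s t * C s t|) := by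
          refine (norm_sum_le _ _).trans (Finset.sum_le_sum fun s _ =>
            (norm_sum_le _ _).trans (Finset.sum_le_sum fun t _ => ?_))
          rw [norm_mul, norm_mul, RCLike.norm_conj, Complex.norm_real, Real.norm_eq_abs, abs_mul,
            abs_two, ← hsym s t]
          nlinarith [mul_nonneg (sq_nonneg (‖v s‖ - ‖v t‖)) (abs_nonneg (T s t * C s t))]
      _ = ∑ s, ‖v s‖ ^ 2 * ∑ r, 2 * |T r s * C r s| := by
          simp only [Finset.sum_add_distrib]
          rw [Finset.sum_comm (f := fun s t => ‖v t‖ ^ 2 * |T s t * C s t|),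
            ← Finset.sum_add_distrib]
          refine Finset.sum_congr rfl fun s _ => ?_
          rw [← Finset.sum_add_distrib, Finset.mul_sum]
          exact Finset.sum_congr rfl fun t _ => by ring
  have hpos : 0 < ∑ r, ‖v r‖ ^ 2 := by
    obtain ⟨r, hr⟩ := Function.ne_iff.1 hv
    exact Finset.sum_pos' (fun _ _ => by positivity)
      ⟨r, Finset.mem_univ r, by have : 0 < ‖v r‖ := norm_pos_iff.2 hr
                                positivity⟩
  have e6 : μ ^ 2 * ∑ r, ‖v r‖ ^ 2 ≤ D * ∑ r, ‖v r‖ ^ 2 := by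
    have h1 : μ ^ 2 * ∑ r, ‖v r‖ ^ 2 - ∑ s, ‖v s‖ ^ 2 * b s ≤
        ∑ s, ‖v s‖ ^ 2 * ∑ r, 2 * |T r s * C r s| := by
      refine le_trans ?_ e5
      rw [← sub_eq_iff_eq_add'.2 e4, ← Complex.ofReal_sub, Complex.norm_real]
      exact Real.le_norm_self _
    calc _ ≤ ∑ s, ‖v s‖ ^ 2 * b s + ∑ s, ‖v s‖ ^ 2 * ∑ r, 2 * |T r s * C r s| := by linarith
      _ = ∑ s, ‖v s‖ ^ 2 * ∑ r, (T r s ^ 2 + 2 * |T r s * C r s|) := by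
          simp only [hb, ← Finset.sum_add_distrib, ← mul_add]
      _ ≤ ∑ s, ‖v s‖ ^ 2 * D := by gcongr with s; exact hD s
      _ = _ := by rw [← Finset.sum_mul, mul_comm]
  exact le_of_mul_le_mul_right e6 hpos

open scoped ComplexOrder in
/-- The Hilbert inequality: a Hermitian form whose eigenvalues are bounded by `E` in absolute value
is bounded by `E` times the squared norm. -/
theorem norm_sum_cscMatrix_le (hθ : ∀ r s, r ≠ s → Real.sin (θ r - θ s) ≠ 0) {E : ℝ} (hE : 0 ≤ E)
    (hD : ∀ s, ∑ r, (cscMatrix θ r s ^ 2 + 2 * |cscMatrix θ r s * cotMatrix θ r s|) ≤ E ^ 2)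
    (u : ι → ℂ) :
    ‖∑ r, ∑ s, u r * starRingEnd ℂ (u s) * (cscMatrix θ r s : ℂ)‖ ≤ E * ∑ r, ‖u r‖ ^ 2 := by
  -- for either sign `ε`, the matrix `E + ε i T` is positive semidefinite
  have key : ∀ ε : ℝ, ε ^ 2 = 1 → 0 ≤ ((E * ∑ r, ‖u r‖ ^ 2 : ℝ) : ℂ) + ε * Complex.I *
      ∑ r, ∑ s, u r * starRingEnd ℂ (u s) * (cscMatrix θ r s : ℂ) := by
    intro ε hε
    set M : Matrix ι ι ℂ := Matrix.of fun r s =>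
      (if r = s then (E : ℂ) else 0) - ε * Complex.I * (cscMatrix θ r s : ℂ) with hM
    have hH : M.IsHermitian := by
      ext r s
      simp only [hM, Matrix.conjTranspose_apply, Matrix.of_apply, cscMatrix_swap θ r s,
        eq_comm (a := s)]
      split_ifs <;> simp [sub_eq_add_neg]
    have hPSD : M.PosSemidef := by
      rw [hH.posSemidef_iff_eigenvalues_nonneg]
      intro j
      have hev := hH.mulVec_eigenvectorBasis j
      set ν := hH.eigenvalues j
      set v : ι → ℂ := ⇑(hH.eigenvectorBasis j)
      have hv : v ≠ 0 := by
        intro h0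
        have := hH.eigenvectorBasis.orthonormal.ne_zero j
        exact this (by ext i; exact congrFun h0 i)
      have hsq := sq_le_of_cscMatrix_eigenvector hθ hD v hv (ε * (E - ν)) (by
        intro r
        have hr := congrFun hev r
        simp only [hM, Matrix.mulVec, dotProduct, Matrix.of_apply, sub_mul, ite_mul, zero_mul,
          Finset.sum_sub_distrib, Finset.sum_ite_eq, Finset.mem_univ, if_true, Pi.smul_apply,
          Complex.real_smul] at hr
        have h2 : ∑ s, ε * Complex.I * (cscMatrix θ r s : ℂ) * v s =
            ε * Complex.I * ∑ s, (cscMatrix θ r s : ℂ) * v s := by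
          rw [Finset.mul_sum]
          exact Finset.sum_congr rfl fun s _ => by ring
        rw [h2] at hr
        have hε' : (ε : ℂ) ^ 2 = 1 := by exact_mod_cast hε
        set X := ∑ s, (cscMatrix θ r s : ℂ) * v s
        push_cast
        linear_combination (ε * Complex.I) * hr + (ε ^ 2 * X) * Complex.I_sq - X * hε')
      rw [mul_pow, hε, one_mul] at hsq
      have := abs_le_of_sq_le_sq' hsq hE
      show 0 ≤ ν
      linarith [this.2]
    have h := hPSD.dotProduct_mulVec_nonneg u
    convert h using 1
    simp only [hM, Matrix.mulVec, dotProduct, Matrix.of_apply, Pi.star_apply, sub_mul, ite_mul,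
      zero_mul, Finset.sum_sub_distrib, Finset.sum_ite_eq, Finset.mem_univ, if_true, mul_sub]
    rw [sub_eq_add_neg]
    congr 1
    · push_cast
      rw [Finset.mul_sum]
      exact Finset.sum_congr rfl fun r _ => by
        rw [← Complex.mul_conj']; simp only [RCLike.star_def]; ring
    · rw [Finset.sum_comm, Finset.mul_sum, ← Finset.sum_neg_distrib]
      refine Finset.sum_congr rfl fun s _ => ?_
      rw [Finset.mul_sum, Finset.mul_sum, ← Finset.sum_neg_distrib]
      refine Finset.sum_congr rfl fun r _ => ?_
      rw [cscMatrix_swap θ s r]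
      push_cast
      simp only [RCLike.star_def]
      ring
  have hp := key 1 (by norm_num)
  have hm := key (-1) (by norm_num)
  set Q := ∑ r, ∑ s, u r * starRingEnd ℂ (u s) * (cscMatrix θ r s : ℂ)
  set S := ∑ r, ‖u r‖ ^ 2
  rw [Complex.le_def] at hp hm
  simp at hp hm
  rw [Complex.norm_eq_sqrt_sq_add_sq, ← hp.2, zero_pow two_ne_zero, zero_add, Real.sqrt_sq_eq_abs]
  exact abs_le.2 ⟨by linarith, by linarith⟩

end Kernels

/-! ### Mean squares of exponential sums over an interval of integers -/

/-- The additive character `e(t) = exp(2 π i t)` of the real line. -/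
noncomputable def addChar (t : ℝ) : ℂ := Complex.exp (2 * Real.pi * Complex.I * (t : ℂ))

theorem addChar_add (s t : ℝ) : addChar (s + t) = addChar s * addChar t := by
  rw [addChar, addChar, addChar, ← Complex.exp_add]
  push_cast
  ring_nf

theorem addChar_conj (t : ℝ) : starRingEnd ℂ (addChar t) = addChar (-t) := by
  rw [addChar, addChar, ← Complex.exp_conj]
  simp [map_ofNat]

theorem norm_addChar (t : ℝ) : ‖addChar t‖ = 1 := by
  rw [addChar, show 2 * (Real.pi : ℂ) * Complex.I * (t : ℂ) =
    ((2 * Real.pi * t : ℝ) : ℂ) * Complex.I by push_cast; ring, Complex.norm_exp_ofReal_mul_I]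

theorem addChar_int (n : ℤ) : addChar n = 1 := by
  rw [addChar, ← Complex.exp_int_mul_two_pi_mul_I n]
  congr 1
  push_cast
  ring

theorem addChar_half_sub (t : ℝ) :
    addChar (1 / 2 * t) - addChar (-(1 / 2 * t)) =
      2 * Complex.I * (Real.sin (Real.pi * t) : ℂ) := by
  rw [addChar, addChar, Complex.ofReal_sin, Complex.sin]
  push_cast
  ring_nf
  rw [Complex.I_sq]
  ring_nf

/-- The Dirichlet kernel of the interval `[A, B]`. -/
theorem sum_addChar_mul (t : ℝ) (ht : Real.sin (Real.pi * t) ≠ 0) {A B : ℤ} (hAB : A ≤ B) :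
    ∑ k ∈ Finset.Icc A B, addChar (t * k) = 1 / (2 * Complex.I) *
      (addChar ((B + 1 / 2) * t) - addChar ((A - 1 / 2) * t)) *
      ((1 / Real.sin (Real.pi * t) : ℝ) : ℂ) := by
  have hne : (Real.sin (Real.pi * t) : ℂ) ≠ 0 := by exact_mod_cast ht
  have hstep : ∀ k : ℤ, addChar (t * k) * (2 * Complex.I * (Real.sin (Real.pi * t) : ℂ)) =
      addChar ((k + 1 / 2) * t) - addChar ((k - 1 / 2) * t) := by
    intro k
    rw [← addChar_half_sub, mul_sub, ← addChar_add, ← addChar_add]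
    ring_nf
  have htel : ∑ k ∈ Finset.Icc A B, (addChar ((k + 1 / 2) * t) - addChar ((k - 1 / 2) * t)) =
      addChar ((B + 1 / 2) * t) - addChar ((A - 1 / 2) * t) := by
    induction B, hAB using Int.leInduction with
    | base => simp
    | succ n hn ih =>
      rw [← Finset.insert_Icc_right_eq_Icc_add_one (by omega), Finset.sum_insert (by simp), ih]
      push_cast
      ring_nf
  rw [← htel, ← Finset.sum_congr rfl fun k _ => hstep k, ← Finset.sum_mul,
    Complex.ofReal_div, Complex.ofReal_one]
  generalize (Real.sin (Real.pi * t) : ℂ) = z at hne ⊢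
  field_simp

variable {ι : Type*} [Fintype ι]

/-- Reduction of the differences `x r - x s` to `[-1/2, 1/2]` turns separation modulo `1` into
separation on the line. -/
theorem sum_cscMatrix_sq_add_le [DecidableEq ι] (x : ι → ℝ) {δ : ℝ} (hδ : 0 < δ)
    (hx : ∀ r s, r ≠ s → ∀ k : ℤ, δ ≤ |x r - x s - k|) (s : ι) :
    ∑ r, (cscMatrix (fun r => Real.pi * x r) r s ^ 2 +
      2 * |cscMatrix (fun r => Real.pi * x r) r s * cotMatrix (fun r => Real.pi * x r) r s|) ≤
      (1 / δ) ^ 2 := by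
  set d : ι → ℝ := fun r => x r - x s - round (x r - x s) with hd
  have hterm : ∀ r ∈ Finset.univ.erase s, (cscMatrix (fun r => Real.pi * x r) r s ^ 2 +
      2 * |cscMatrix (fun r => Real.pi * x r) r s * cotMatrix (fun r => Real.pi * x r) r s|) ≤
      3 / Real.pi ^ 2 * (1 / d r ^ 2) := by
    intro r hr
    have hd0 : d r ≠ 0 := by
      have := hx r s (Finset.ne_of_mem_erase hr) (round (x r - x s))
      intro h0
      rw [show x r - x s - _ = d r from rfl, h0, abs_zero] at this
      linarith
    refine le_trans (le_of_eq ?_) (inv_sin_sq_add_le (abs_sub_round _) hd0)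
    have harg : Real.pi * x r - Real.pi * x s = Real.pi * d r + round (x r - x s) * Real.pi := by
      simp only [hd]; ring
    simp only [cscMatrix, cotMatrix, harg, Real.sin_add_int_mul_pi, Real.cos_add_int_mul_pi]
    have hu : ((-1 : ℝ) ^ round (x r - x s)) = 1 ∨ ((-1 : ℝ) ^ round (x r - x s)) = -1 := by
      rcases Int.even_or_odd (round (x r - x s)) with h | h
      · exact Or.inl h.neg_one_zpow
      · exact Or.inr h.neg_one_zpow
    rcases hu with h | h <;> rw [h] <;> simp
  rw [← Finset.sum_erase (a := s) _ (by simp)]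
  refine (Finset.sum_le_sum hterm).trans ?_
  rw [← Finset.mul_sum]
  have h := sum_one_div_sq_le (Finset.univ.erase s) d hδ
    (fun r hr => hx r s (Finset.ne_of_mem_erase hr) _) (fun r _ t _ hrt => by
      have := hx r t hrt (round (x r - x s) - round (x t - x s))
      refine this.trans (le_of_eq (congrArg _ ?_))
      simp only [hd]
      push_cast
      ring)
  calc _ ≤ 3 / Real.pi ^ 2 * (Real.pi ^ 2 / (3 * δ ^ 2)) := by gcongr
    _ = (1 / δ) ^ 2 := by field_simp

/-- The mean square over `[A, B]` differs from that of orthogonal terms by at most `1 / δ` times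
the squared norm of the coefficients. -/
theorem abs_sum_norm_sq_sub_le (x : ι → ℝ) {δ : ℝ} (hδ : 0 < δ)
    (hx : ∀ r s, r ≠ s → ∀ k : ℤ, δ ≤ |x r - x s - k|) (c : ι → ℂ) {A B : ℤ} (hAB : A ≤ B) :
    |∑ k ∈ Finset.Icc A B, ‖∑ r, c r * addChar (x r * k)‖ ^ 2 -
      (B - A + 1) * ∑ r, ‖c r‖ ^ 2| ≤ 1 / δ * ∑ r, ‖c r‖ ^ 2 := by
  classical
  set θ : ι → ℝ := fun r => Real.pi * x r with hθdef
  have hθ : ∀ r s, r ≠ s → Real.sin (θ r - θ s) ≠ 0 := by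
    intro r s hrs h0
    obtain ⟨n, hn⟩ := Real.sin_eq_zero_iff.1 h0
    have h1 : x r - x s - n = 0 := by
      have : Real.pi * (x r - x s - n) = 0 := by
        simp only [hθdef] at hn; linarith
      exact (mul_eq_zero.1 this).resolve_left Real.pi_ne_zero
    have := hx r s hrs n
    rw [h1, abs_zero] at this
    linarith
  set w : ℝ → ι → ℂ := fun a r => c r * addChar (a * x r) with hw
  have hQ : ∀ a, ‖∑ r, ∑ s, w a r * starRingEnd ℂ (w a s) * (cscMatrix θ r s : ℂ)‖ ≤
      1 / δ * ∑ r, ‖c r‖ ^ 2 := by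
    intro a
    have := norm_sum_cscMatrix_le hθ (one_div_pos.2 hδ).le (sum_cscMatrix_sq_add_le x hδ hx) (w a)
    simpa only [hw, norm_mul, norm_addChar, mul_one] using this
  have hww : ∀ a r s, w a r * starRingEnd ℂ (w a s) =
      c r * starRingEnd ℂ (c s) * addChar (a * (x r - x s)) := by
    intro a r s
    rw [mul_sub, sub_eq_add_neg, addChar_add, ← addChar_conj]
    simp only [hw, map_mul]
    ring
  have hexp : ((∑ k ∈ Finset.Icc A B, ‖∑ r, c r * addChar (x r * k)‖ ^ 2 : ℝ) : ℂ) =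
      ∑ r, ∑ s, c r * starRingEnd ℂ (c s) * ∑ k ∈ Finset.Icc A B, addChar ((x r - x s) * k) := by
    push_cast
    simp_rw [← Complex.mul_conj', map_sum, Finset.sum_mul_sum, Finset.mul_sum]
    rw [Finset.sum_comm]
    refine Finset.sum_congr rfl fun r _ => ?_
    rw [Finset.sum_comm]
    refine Finset.sum_congr rfl fun s _ => Finset.sum_congr rfl fun k _ => ?_
    rw [sub_mul, sub_eq_add_neg, addChar_add, ← addChar_conj, map_mul]
    ring
  have hent : ∀ r s, c r * starRingEnd ℂ (c s) * ∑ k ∈ Finset.Icc A B, addChar ((x r - x s) * k) =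
      (if r = s then (((B - A + 1) * ‖c r‖ ^ 2 : ℝ) : ℂ) else 0) + 1 / (2 * Complex.I) *
      (w (B + 1 / 2) r * starRingEnd ℂ (w (B + 1 / 2) s) * (cscMatrix θ r s : ℂ) -
        w (A - 1 / 2) r * starRingEnd ℂ (w (A - 1 / 2) s) * (cscMatrix θ r s : ℂ)) := by
    intro r s
    by_cases hrs : r = s
    · subst hrs
      have h1 : addChar 0 = 1 := by simpa using addChar_int 0
      have hcard : (((B + 1 - A).toNat : ℕ) : ℂ) = B - A + 1 := by
        rw [← Int.cast_natCast, Int.toNat_of_nonneg (by omega)]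
        push_cast
        ring
      simp [h1, Complex.mul_conj', hcard]
      ring
    · have h0 : θ r - θ s = Real.pi * (x r - x s) := by simp only [hθdef]; ring
      rw [sum_addChar_mul _ (h0 ▸ hθ r s hrs) hAB, hww, hww, cscMatrix, h0, if_neg hrs]
      ring
  have hmain : ((∑ k ∈ Finset.Icc A B, ‖∑ r, c r * addChar (x r * k)‖ ^ 2 -
      (B - A + 1) * ∑ r, ‖c r‖ ^ 2 : ℝ) : ℂ) = 1 / (2 * Complex.I) *
      (∑ r, ∑ s, w (B + 1 / 2) r * starRingEnd ℂ (w (B + 1 / 2) s) * (cscMatrix θ r s : ℂ) -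
        ∑ r, ∑ s, w (A - 1 / 2) r * starRingEnd ℂ (w (A - 1 / 2) s) * (cscMatrix θ r s : ℂ)) := by
    rw [Complex.ofReal_sub, hexp]
    simp only [hent, Finset.sum_add_distrib, Finset.sum_ite_eq, Finset.mem_univ, if_true,
      ← Finset.mul_sum, Finset.sum_sub_distrib, ← Complex.ofReal_sum]
    ring
  rw [← Real.norm_eq_abs, ← Complex.norm_real, hmain, norm_mul]
  have h2 : ‖(1 / (2 * Complex.I) : ℂ)‖ = 1 / 2 := by simp
  rw [h2]
  have := norm_sub_le_of_le (hQ (B + 1 / 2)) (hQ (A - 1 / 2))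
  linarith

/-! ### Dilation of the frequencies -/

theorem sum_fin_addChar_mul_div {K : ℕ} (hK : 0 < K) (k : ℤ) :
    ∑ j : Fin K, addChar ((j : ℕ) / K * k) = if (K : ℤ) ∣ k then (K : ℂ) else 0 := by
  have hK' : (K : ℝ) ≠ 0 := by positivity
  set z := addChar (k / K) with hz
  have hpow : ∀ j : ℕ, addChar (j / K * k) = z ^ j := by
    intro j
    rw [hz, addChar, addChar, ← Complex.exp_nat_mul]
    push_cast
    ring_nf
  simp only [hpow]
  rw [Fin.sum_univ_eq_sum_range (fun j => z ^ j)]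
  split_ifs with h
  · obtain ⟨m, rfl⟩ := h
    have : z = 1 := by
      rw [hz, ← addChar_int m]
      congr 1
      push_cast
      field_simp
    simp [this]
  · have hzK : z ^ K = 1 := by
      rw [← hpow, ← addChar_int k]
      congr 1
      field_simp
    have hz1 : z ≠ 1 := by
      intro h1
      obtain ⟨n, hn⟩ := Complex.exp_eq_one_iff.1 h1
      apply h
      refine ⟨n, ?_⟩
      have h3 : (((k : ℝ) / K : ℝ) : ℂ) = n :=
        mul_left_cancel₀ Complex.two_pi_I_ne_zero (by linear_combination hn)
      have h4 : (k : ℝ) / K = n := by exact_mod_cast h3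
      rw [div_eq_iff hK'] at h4
      have h5 : (k : ℝ) = K * n := by linarith
      exact_mod_cast h5
    rw [geom_sum_eq hz1, hzK, sub_self, zero_div]

/-- Cohen's dilation: each frequency `x r` is replaced by the `K` frequencies `(x r + j) / K`, whose
sum vanishes off the multiples of `K`. Hence `[A', B']` may be any interval of integers in which
the multiples of `K` are those from `K A` to `K B`. -/
theorem abs_mul_sum_norm_sq_sub_le (x : ι → ℝ) {q : ℝ} (hq : 0 < q) (hq1 : q ≤ 1)
    (hx : ∀ r s, r ≠ s → ∀ k : ℤ, q ≤ |x r - x s - k|) (c : ι → ℂ) {A B A' B' : ℤ} (hAB : A ≤ B)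
    {K : ℕ} (hK : 0 < K) (hA : A' ≤ K * A) (hB : K * B ≤ B') (hA' : K * (A - 1) < A')
    (hB' : B' < K * (B + 1)) :
    |K * ∑ k ∈ Finset.Icc A B, ‖∑ r, c r * addChar (x r * k)‖ ^ 2 -
      (B' - A' + 1) * ∑ r, ‖c r‖ ^ 2| ≤ K / q * ∑ r, ‖c r‖ ^ 2 := by
  have hKr : (0 : ℝ) < K := by exact_mod_cast hK
  have hKz : (0 : ℤ) < K := by exact_mod_cast hK
  set X : ι × Fin K → ℝ := fun p => (x p.1 + (p.2 : ℕ)) / K with hX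
  have hsep : ∀ p p', p ≠ p' → ∀ k : ℤ, q / K ≤ |X p - X p' - k| := by
    rintro ⟨r, i⟩ ⟨s, j⟩ hne k
    have e : X (r, i) - X (s, j) - k =
        (x r - x s - ((k * K - (i : ℕ) + (j : ℕ) : ℤ) : ℝ)) / K := by
      simp only [hX]
      push_cast
      field_simp
      ring
    rw [e, abs_div, abs_of_pos hKr]
    refine div_le_div_of_nonneg_right ?_ hKr.le
    by_cases hrs : r = s
    · subst hrs
      have hij : (i : ℕ) ≠ j := fun h => hne (by rw [Fin.ext h])
      have hn : (k * K - (i : ℕ) + (j : ℕ) : ℤ) ≠ 0 := by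
        intro h0
        have hi := i.2
        have hj := j.2
        have hk : k = 0 := by
          by_contra hk
          rcases lt_or_gt_of_ne hk with h | h <;> nlinarith
        subst hk
        omega
      rw [sub_self, zero_sub, abs_neg, ← Int.cast_abs]
      exact hq1.trans (by exact_mod_cast Int.one_le_abs hn)
    · exact hx r s hrs _
  have hA'B' : A' ≤ B' := by nlinarith
  have h := abs_sum_norm_sq_sub_le X (div_pos hq hKr) hsep (fun p => c p.1) hA'B'
  have hc : ∑ p : ι × Fin K, ‖c p.1‖ ^ 2 = K * ∑ r, ‖c r‖ ^ 2 := by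
    rw [Fintype.sum_prod_type, Finset.mul_sum]
    simp
  have hg : ∀ k : ℤ, ∑ p : ι × Fin K, c p.1 * addChar (X p * k) =
      if (K : ℤ) ∣ k then K * ∑ r, c r * addChar (x r * (k / K)) else 0 := by
    intro k
    have : ∀ r (j : Fin K), c r * addChar (X (r, j) * k) =
        c r * addChar (x r * (k / K)) * addChar ((j : ℕ) / K * k) := by
      intro r j
      rw [mul_assoc, ← addChar_add]
      simp only [hX]
      ring_nf
    rw [Fintype.sum_prod_type]
    simp only [this, ← Finset.mul_sum, sum_fin_addChar_mul_div hK]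
    split_ifs
    · rw [← Finset.sum_mul, mul_comm]
    · simp
  have hsum : ∑ k ∈ Finset.Icc A' B', ‖∑ p : ι × Fin K, c p.1 * addChar (X p * k)‖ ^ 2 =
      K ^ 2 * ∑ k ∈ Finset.Icc A B, ‖∑ r, c r * addChar (x r * k)‖ ^ 2 := by
    have hinj : Set.InjOn (fun m : ℤ => (K : ℤ) * m) (Finset.Icc A B : Set ℤ) :=
      fun a _ b _ hab => mul_left_cancel₀ hKz.ne' hab
    rw [← Finset.sum_subset (s₁ := (Finset.Icc A B).image fun m : ℤ => (K : ℤ) * m),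
      Finset.sum_image hinj, Finset.mul_sum]
    · refine Finset.sum_congr rfl fun m _ => ?_
      rw [hg, if_pos (dvd_mul_right _ _), norm_mul, mul_pow, Complex.norm_natCast]
      have : (((K : ℤ) * m : ℤ) : ℝ) / K = m := by
        push_cast
        field_simp
      rw [this]
    · intro k hk
      obtain ⟨m, hm, rfl⟩ := Finset.mem_image.1 hk
      rw [Finset.mem_Icc] at hm ⊢
      constructor <;> nlinarith
    · intro k hk hk'
      rw [hg, if_neg]
      · simp
      · rintro ⟨m, rfl⟩
        rw [Finset.mem_Icc] at hk
        refine hk' (Finset.mem_image_of_mem _ (Finset.mem_Icc.2 ⟨?_, ?_⟩))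
        · have : (K : ℤ) * (A - 1) < K * m := by linarith
          have := lt_of_mul_lt_mul_left this hKz.le
          omega
        · have : (K : ℤ) * m < K * (B + 1) := by linarith
          have := lt_of_mul_lt_mul_left this hKz.le
          omega
  rw [hsum, hc] at h
  refine le_of_mul_le_mul_left ?_ hKr
  rw [← abs_of_pos hKr, ← abs_mul, abs_of_pos hKr]
  refine (le_of_eq (congrArg _ ?_)).trans (h.trans (le_of_eq ?_))
  · ring
  · field_simp

/-! ### The two inequalities -/

theorem le_wrapDist_of_le_sep {Y : Finset ℝ} {q : ℝ} (h : (q : EReal) ≤ sep Y) {y y' : ℝ}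
    (hy : y ∈ Y) (hy' : y' ∈ Y) (hne : y ≠ y') : q ≤ wrapDist y y' := by
  have : sep Y ≤ ((wrapDist y y' : ℝ) : EReal) :=
    iInf_le_of_le y (iInf_le_of_le hy (iInf_le_of_le y'
      (iInf_le_of_le hy' (iInf_le_of_le hne le_rfl))))
  exact EReal.coe_le_coe_iff.1 (h.trans this)

theorem theorem2 (q : ℝ) (hq : 0 < q) (hq1 : q ≤ 1) (f : ExpSum) (hf : f ∈ WellSeparated q)
    (A B : ℤ) (hAB : A < B) :
    ((B : ℝ) - (A : ℝ) + 2 - 1 / q) * ‖f.coeff‖ ^ 2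
        ≤ ∑ k ∈ Finset.Icc A B, ‖f.eval (k : ℝ)‖ ^ 2 ∧
      ∑ k ∈ Finset.Icc A B, ‖f.eval (k : ℝ)‖ ^ 2
        ≤ ((B : ℝ) - (A : ℝ) + 1 / q) * ‖f.coeff‖ ^ 2 := by
  have hx : ∀ r s : f.freq, r ≠ s → ∀ k : ℤ, q ≤ |(r : ℝ) - s - k| := fun r s hrs k =>
    (le_wrapDist_of_le_sep hf r.2 s.2 fun h => hrs (Subtype.ext h)).trans
      ((wrapDist_isLeast r s).2 ⟨k, rfl⟩)
  have heval : ∀ t : ℝ, f.eval t = ∑ r : f.freq, f.coeff r * addChar (r * t) := by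
    intro t
    refine Finset.sum_congr rfl fun r _ => ?_
    rw [addChar]
    push_cast
    ring_nf
  simp only [heval, EuclideanSpace.norm_sq_eq]
  set S := ∑ r : f.freq, ‖f.coeff r‖ ^ 2
  set F := ∑ k ∈ Finset.Icc A B, ‖∑ r : f.freq, f.coeff r * addChar (r * k)‖ ^ 2
  -- the bounds obtained from the dilation by `K` have an excess of `S / K`
  have hlim : Filter.Tendsto (fun K : ℕ => 1 / (K : ℝ) * S) Filter.atTop (nhds 0) := by
    simpa using tendsto_one_div_atTop_nhds_zero_nat.mul_const S
  constructor
  · -- the longest interval whose multiples of `K` are `K A, …, K B`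
    have hK : ∀ᶠ K : ℕ in Filter.atTop, (B - A + 2 - 1 / q) * S - F ≤ 1 / (K : ℝ) * S := by
      filter_upwards [Filter.eventually_gt_atTop 0] with K hK
      have hKr : (0 : ℝ) < K := by exact_mod_cast hK
      have hKz : (0 : ℤ) < K := by exact_mod_cast hK
      have h := abs_mul_sum_norm_sq_sub_le (fun r : f.freq => (r : ℝ)) hq hq1 hx
        (fun r => f.coeff r) hAB.le (A' := K * (A - 1) + 1) (B' := K * (B + 1) - 1) hK
        (by linarith) (by linarith) (by linarith) (by linarith)
      have h2 := (abs_le.1 h).1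
      push_cast at h2
      refine le_of_mul_le_mul_left ?_ hKr
      have e1 : (K : ℝ) * (1 / (K : ℝ) * S) = S := by field_simp
      have e2 : (K : ℝ) / q * S = K * (1 / q * S) := by ring
      rw [e1]
      rw [e2] at h2
      linarith
    linarith [ge_of_tendsto hlim hK]
  · -- the shortest one
    have hK : ∀ᶠ K : ℕ in Filter.atTop, F - (B - A + 1 / q) * S ≤ 1 / (K : ℝ) * S := by
      filter_upwards [Filter.eventually_gt_atTop 0] with K hK
      have hKr : (0 : ℝ) < K := by exact_mod_cast hK
      have hKz : (0 : ℤ) < K := by exact_mod_cast hK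
      have h := abs_mul_sum_norm_sq_sub_le (fun r : f.freq => (r : ℝ)) hq hq1 hx
        (fun r => f.coeff r) hAB.le (A' := K * A) (B' := K * B) hK le_rfl le_rfl
        (by linarith) (by linarith)
      have h2 := (abs_le.1 h).2
      push_cast at h2
      refine le_of_mul_le_mul_left ?_ hKr
      have e1 : (K : ℝ) * (1 / (K : ℝ) * S) = S := by field_simp
      have e2 : (K : ℝ) / q * S = K * (1 / q * S) := by ring
      rw [e1]
      rw [e2] at h2
      linarith
    linarith [ge_of_tendsto hlim hK]
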